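/- **Proposition (Additivity of the channel entropy).** All quantum systems are finite-dimensional and nonzero; $|B|$ denotes the dimension of a system $B$. A state is a positive semidefinite operator of unit trace, and a quantum channel is a completely positive, trace-preserving linear map. For a state $\rho$ and a positive semidefinite operator $\sigma$, let $D(\rho\Vert\sigma)=\operatorname{Tr}\{\rho[\log_2\rho-\log_2\sigma]\}$ if $\operatorname{supp}(\rho)\subseteq\operatorname{supp}(\sigma)$ and $D(\rho\Vert\sigma)=+\infty$ otherwise. For channels $\mathcal{N}_{A\to B}$ and $\mathcal{M}_{A\to B}$ let $$D(\mathcal{N}\Vert\mathcal{M})=\sup_{\rho_{RA}}D\big((\operatorname{id}_R\otimes\mathcal{N})(\rho_{RA})\,\big\Vert\,(\operatorname{id}_R\otimes\mathcal{M})(\rho_{RA})\big),$$ where the supremum is over all states $\rho_{RA}$ with a reference system $R$ of arbitrary (finite) dimension. Let $\mathcal{R}_{A\to B}(X)=\operatorname{Tr}\{X\}\,I_B/|B|$ be the completely randomizing channel, and define the entropy of a channel $\mathcal{N}_{A\to B}$ by $$H(\mathcal{N})=\log_2|B|-D(\mathcal{N}\Vert\mathcal{R}_{A\to B}).$$ Let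 $\mathcal{N}_{A_1\to B_1}$ and $\mathcal{M}_{A_2\to B_2}$ be quantum channels. Then $$H(\mathcal{N}\otimes\mathcal{M})=H(\mathcal{N})+H(\mathcal{M}),$$ and, equivalently, $$D(\mathcal{N}\otimes\mathcal{M}\Vert\mathcal{R}_{A_1\to B_1}\otimes\mathcal{R}_{A_2\to B_2})=D(\mathcal{N}\Vert\mathcal{R}_{A_1\to B_1})+D(\mathcal{M}\Vert\mathcal{R}_{A_2\to B_2}).$$ -/

import Mathlib

open scoped Kronecker ComplexOrder

namespace QuantumChannel

/-- A state (density operator) of a finite quantum system with orthonormal basis labelled by `A`: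
a positive semidefinite matrix of unit trace. -/
def IsState {A : Type*} [Fintype A] (ρ : Matrix A A ℂ) : Prop :=
  ρ.PosSemidef ∧ ρ.trace = 1

/-- The tensor product `N ⊗ M` of two linear maps on operators, expanded on matrix units.
The composite of the systems `A₁` and `A₂` has its basis labelled by `A₁ × A₂`. It is the linear
map determined by `(N ⊗ M) (X ⊗ Y) = N X ⊗ M Y`, see `tensor_kronecker`. -/
noncomputable def tensor {A₁ A₂ B₁ B₂ : Type*} [Fintype A₁] [DecidableEq A₁]
    [Fintype A₂] [DecidableEq A₂]
    (N : Matrix A₁ A₁ ℂ →ₗ[ℂ] Matrix B₁ B₁ ℂ) (M : Matrix A₂ A₂ ℂ →ₗ[ℂ] Matrix B₂ B₂ ℂ) :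
    Matrix (A₁ × A₂) (A₁ × A₂) ℂ →ₗ[ℂ] Matrix (B₁ × B₂) (B₁ × B₂) ℂ where
  toFun X := ∑ i : A₁ × A₂, ∑ j : A₁ × A₂,
    X i j • (N (Matrix.single i.1 j.1 1) ⊗ₖ M (Matrix.single i.2 j.2 1))
  map_add' X Y := by
    simp only [Matrix.add_apply, add_smul, Finset.sum_add_distrib]
  map_smul' c X := by
    simp only [Matrix.smul_apply, smul_eq_mul, mul_smul, Finset.smul_sum, RingHom.id_apply]

/-- Complete positivity: `id ⊗ N` preserves positive semidefiniteness for every finite ancilla. -/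
def IsCompletelyPositive {A B : Type*} [Fintype A] [DecidableEq A] [Fintype B]
    (N : Matrix A A ℂ →ₗ[ℂ] Matrix B B ℂ) : Prop :=
  ∀ (k : ℕ) (X : Matrix (Fin k × A) (Fin k × A) ℂ), X.PosSemidef →
    (tensor (LinearMap.id : Matrix (Fin k) (Fin k) ℂ →ₗ[ℂ] Matrix (Fin k) (Fin k) ℂ) N
      X).PosSemidef

/-- A quantum channel: a completely positive, trace preserving linear map. -/
structure IsChannel {A B : Type*} [Fintype A] [DecidableEq A] [Fintype B]
    (N : Matrix A A ℂ →ₗ[ℂ] Matrix B B ℂ) : Prop where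
  completelyPositive : IsCompletelyPositive N
  trace_preserving : ∀ X : Matrix A A ℂ, (N X).trace = X.trace

open Classical in
/-- The quantum relative entropy `D(ρ‖σ) = Tr[ρ (log₂ ρ - log₂ σ)]` if
`supp ρ ⊆ supp σ` (for Hermitian matrices: `ker σ ⊆ ker ρ`), and `+∞` otherwise.
The logarithms are taken by functional calculus on the support, as `Real.logb 2 0 = 0`. -/
noncomputable def relEntropy {A : Type*} [Fintype A] [DecidableEq A]
    (ρ σ : Matrix A A ℂ) : EReal :=
  if ∀ v : A → ℂ, σ.mulVec v = 0 → ρ.mulVec v = 0 then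
    (((ρ * (cfc (Real.logb 2) ρ - cfc (Real.logb 2) σ)).trace.re : ℝ) : EReal)
  else ⊤

/-- The relative entropy of channels: the supremum of
`D((id ⊗ N) ρ ‖ (id ⊗ M) ρ)` over all states `ρ` of a reference system of arbitrary finite
dimension `n` together with the input system. -/
noncomputable def channelRelEntropy {A B : Type*} [Fintype A] [DecidableEq A]
    [Fintype B] [DecidableEq B] (N M : Matrix A A ℂ →ₗ[ℂ] Matrix B B ℂ) : EReal :=
  ⨆ (n : ℕ) (ρ : Matrix (Fin n × A) (Fin n × A) ℂ) (_ : IsState ρ),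
    relEntropy
      (tensor (LinearMap.id : Matrix (Fin n) (Fin n) ℂ →ₗ[ℂ] Matrix (Fin n) (Fin n) ℂ) N ρ)
      (tensor (LinearMap.id : Matrix (Fin n) (Fin n) ℂ →ₗ[ℂ] Matrix (Fin n) (Fin n) ℂ) M ρ)

/-- The completely randomizing channel `X ↦ Tr[X] π_B`, where `π_B = I / |B|`. -/
noncomputable def randomizing (A B : Type*) [Fintype A] [Fintype B] [DecidableEq B] :
    Matrix A A ℂ →ₗ[ℂ] Matrix B B ℂ :=
  (Matrix.traceLinearMap A ℂ ℂ).smulRight ((Fintype.card B : ℂ)⁻¹ • (1 : Matrix B B ℂ))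

/-- The entropy of a channel, `H(N) = log₂ |B| - D(N‖R)`. -/
noncomputable def channelEntropy {A B : Type*} [Fintype A] [DecidableEq A]
    [Fintype B] [DecidableEq B] (N : Matrix A A ℂ →ₗ[ℂ] Matrix B B ℂ) : EReal :=
  ((Real.logb 2 (Fintype.card B) : ℝ) : EReal) - channelRelEntropy N (randomizing A B)

/-- The defining property of the tensor product of linear maps. -/
theorem tensor_kronecker {A₁ A₂ B₁ B₂ : Type*} [Fintype A₁] [DecidableEq A₁]
    [Fintype A₂] [DecidableEq A₂]
    (N : Matrix A₁ A₁ ℂ →ₗ[ℂ] Matrix B₁ B₁ ℂ) (M : Matrix A₂ A₂ ℂ →ₗ[ℂ] Matrix B₂ B₂ ℂ)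
    (X : Matrix A₁ A₁ ℂ) (Y : Matrix A₂ A₂ ℂ) :
    tensor N M (X ⊗ₖ Y) = N X ⊗ₖ M Y := by
  have hX : N X = ∑ i, ∑ j, X i j • N (Matrix.single i j 1) := by
    conv_lhs => rw [Matrix.matrix_eq_sum_single X]
    simp only [map_sum]
    refine Finset.sum_congr rfl fun i _ => Finset.sum_congr rfl fun j _ => ?_
    rw [← map_smul, Matrix.smul_single, smul_eq_mul, mul_one]
  have hY : M Y = ∑ i, ∑ j, Y i j • M (Matrix.single i j 1) := by
    conv_lhs => rw [Matrix.matrix_eq_sum_single Y]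
    simp only [map_sum]
    refine Finset.sum_congr rfl fun i _ => Finset.sum_congr rfl fun j _ => ?_
    rw [← map_smul, Matrix.smul_single, smul_eq_mul, mul_one]
  ext ⟨b, c⟩ ⟨b', c'⟩
  rw [hX, hY]
  simp only [tensor, LinearMap.coe_mk, AddHom.coe_mk, Matrix.sum_apply, Matrix.smul_apply,
    Matrix.kronecker_apply, smul_eq_mul, Fintype.sum_prod_type]
  rw [Finset.sum_mul_sum]
  refine Finset.sum_congr rfl fun i _ => Finset.sum_congr rfl fun k _ => ?_
  rw [Finset.sum_mul_sum]
  refine Finset.sum_congr rfl fun j _ => Finset.sum_congr rfl fun l _ => ?_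
  ring

end QuantumChannel

/-! On a state `X` of `R × A`, the output of the randomizing channel is `X_R ⊗ 1/|B|`, with `X_R`
the marginal of `X` on `R`. A trace-preserving `N` leaves that marginal unchanged, so the relative
entropy of the two outputs is always finite and equals `log₂ |B| - H(B|R)`, a difference of two von
Neumann entropies (`relEntropy_idTensor_randomizing`). Additivity thus becomes a statement about
conditional entropies.

For `≤`, the chain rule `H(B₁B₂|R) = H(B₁|R) + H(B₂|RB₁)` splits the divergence of `N ⊗ M` exactly
(`outputDivergence_tensor`). The first term is `N` acting with reference `R`, after `A₂` is traced
out; the second is `M` acting with reference `R × B₁`. Since references are arbitrary, each term is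
bounded by its own supremum, and no entropy inequality is needed. For `≥`, product inputs suffice,
because entropy is additive on tensor products of states (`outputDivergence_kronecker`). -/

namespace QuantumChannel

/-! ### Functional calculus and entropy through eigenvalues -/

section Spectral

variable {m n : Type*} [Fintype m] [DecidableEq m] [Fintype n] [DecidableEq n]

/-- The matrix with eigenvalues `d` and eigenvectors the columns of `U`. -/
noncomputable def spectralMatrix (U : Matrix n n ℂ) (d : n → ℝ) : Matrix n n ℂ :=
  U * Matrix.diagonal (fun i => (d i : ℂ)) * star U

theorem exists_spectralMatrix {X : Matrix n n ℂ} (hX : X.IsHermitian) :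
    ∃ U ∈ Matrix.unitaryGroup n ℂ, ∃ d : n → ℝ, X = spectralMatrix U d :=
  ⟨hX.eigenvectorUnitary, hX.eigenvectorUnitary.2, hX.eigenvalues, hX.spectral_theorem⟩

theorem isHermitian_spectralMatrix (U : Matrix n n ℂ) (d : n → ℝ) :
    (spectralMatrix U d).IsHermitian := by
  refine Matrix.isHermitian_mul_mul_conjTranspose U (Matrix.isHermitian_diagonal_of_self_adjoint _ ?_)
  ext i
  simp

theorem spectralMatrix_mul {U : Matrix n n ℂ} (hU : U ∈ Matrix.unitaryGroup n ℂ) (d e : n → ℝ) :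
    spectralMatrix U d * spectralMatrix U e = spectralMatrix U (fun i => d i * e i) := by
  have h : star U * U = 1 := Matrix.mem_unitaryGroup_iff'.1 hU
  simp only [spectralMatrix, Complex.ofReal_mul]
  rw [← Matrix.diagonal_mul_diagonal]
  simp only [Matrix.mul_assoc]
  rw [← Matrix.mul_assoc (star U) U, h, Matrix.one_mul]

theorem trace_spectralMatrix {U : Matrix n n ℂ} (hU : U ∈ Matrix.unitaryGroup n ℂ) (d : n → ℝ) :
    (spectralMatrix U d).trace = ((∑ i, d i : ℝ) : ℂ) := by
  rw [spectralMatrix, Matrix.trace_mul_cycle, Matrix.mem_unitaryGroup_iff'.1 hU, Matrix.one_mul,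
    Matrix.trace_diagonal, Complex.ofReal_sum]

theorem aeval_spectralMatrix {U : Matrix n n ℂ} (hU : U ∈ Matrix.unitaryGroup n ℂ) (d : n → ℝ)
    (p : Polynomial ℝ) :
    Polynomial.aeval (spectralMatrix U d) p = spectralMatrix U (fun i => p.eval (d i)) := by
  have h : U * star U = 1 := Matrix.mem_unitaryGroup_iff.1 hU
  induction p using Polynomial.induction_on' with
  | add p q hp hq =>
    rw [map_add, hp, hq]
    simp only [spectralMatrix, Polynomial.eval_add, Complex.ofReal_add]
    rw [← Matrix.diagonal_add, Matrix.mul_add, Matrix.add_mul]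
  | monomial k a =>
    have hpow : ∀ k : ℕ, spectralMatrix U d ^ k = spectralMatrix U (fun i => d i ^ k) := by
      intro k
      induction k with
      | zero => simp [spectralMatrix, h]
      | succ k ih => simp only [pow_succ, ih, spectralMatrix_mul hU]
    rw [Polynomial.aeval_monomial, hpow, ← Algebra.smul_def]
    simp only [spectralMatrix, Polynomial.eval_monomial, Complex.ofReal_mul]
    rw [← Matrix.smul_mul, ← Matrix.mul_smul]
    congr 2
    ext i j
    by_cases hij : i = j <;> simp [hij, Matrix.diagonal]

/-- Only finitely many values of `f` matter, so a Lagrange interpolant can replace `f`, and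
polynomials act on the eigenvalues directly. -/
theorem cfc_spectralMatrix {U : Matrix n n ℂ} (hU : U ∈ Matrix.unitaryGroup n ℂ) (d : n → ℝ)
    (f : ℝ → ℝ) : cfc f (spectralMatrix U d) = spectralMatrix U (fun i => f (d i)) := by
  classical
  have hH : IsSelfAdjoint (spectralMatrix U d) := isHermitian_spectralMatrix U d
  -- Taking both sets as nodes avoids proving that the spectrum is the range of `d`.
  set s : Finset ℝ := Matrix.finite_real_spectrum (A := spectralMatrix U d).toFinset ∪
    Finset.univ.image d with hs
  set p : Polynomial ℝ := Lagrange.interpolate s id f with hp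
  have hpf : ∀ x ∈ s, p.eval x = f x := fun x hx =>
    Lagrange.eval_interpolate_at_node (v := id) f Function.injective_id.injOn hx
  have h1 : cfc f (spectralMatrix U d) = cfc (fun x => p.eval x) (spectralMatrix U d) :=
    cfc_congr fun x hx => (hpf x (by simp [hs, hx])).symm
  rw [h1, cfc_polynomial p _ hH, aeval_spectralMatrix hU]
  congr 1
  ext i
  exact hpf _ (by simp [hs])

theorem submatrix_spectralMatrix (e : m ≃ n) (U : Matrix n n ℂ) (d : n → ℝ) :
    (spectralMatrix U d).submatrix e e = spectralMatrix (U.submatrix e e) (d ∘ e) := by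
  simp only [spectralMatrix, Matrix.star_eq_conjTranspose, Matrix.conjTranspose_submatrix]
  rw [← Matrix.submatrix_mul_equiv _ _ e e e, ← Matrix.submatrix_mul_equiv _ _ e e e,
    Matrix.submatrix_diagonal_equiv]
  rfl

theorem submatrix_mem_unitaryGroup (e : m ≃ n) {U : Matrix n n ℂ}
    (hU : U ∈ Matrix.unitaryGroup n ℂ) : U.submatrix e e ∈ Matrix.unitaryGroup m ℂ := by
  rw [Matrix.mem_unitaryGroup_iff, Matrix.star_eq_conjTranspose, Matrix.conjTranspose_submatrix,
    Matrix.submatrix_mul_equiv, ← Matrix.star_eq_conjTranspose, Matrix.mem_unitaryGroup_iff.1 hU,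
    Matrix.submatrix_one_equiv]

theorem spectralMatrix_kronecker (U : Matrix m m ℂ) (d : m → ℝ) (V : Matrix n n ℂ) (e : n → ℝ) :
    spectralMatrix U d ⊗ₖ spectralMatrix V e =
      spectralMatrix (U ⊗ₖ V) (fun i => d i.1 * e i.2) := by
  simp only [spectralMatrix, Matrix.star_eq_conjTranspose, Matrix.conjTranspose_kronecker,
    Complex.ofReal_mul]
  rw [Matrix.mul_kronecker_mul, Matrix.mul_kronecker_mul, Matrix.diagonal_kronecker_diagonal]

/-- The negative of the von Neumann entropy, `Tr[X log₂ X]`. -/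
noncomputable def negEntropy (X : Matrix n n ℂ) : ℝ :=
  (X * cfc (Real.logb 2) X).trace.re

theorem negEntropy_spectralMatrix {U : Matrix n n ℂ} (hU : U ∈ Matrix.unitaryGroup n ℂ)
    (d : n → ℝ) : negEntropy (spectralMatrix U d) = ∑ i, d i * Real.logb 2 (d i) := by
  rw [negEntropy, cfc_spectralMatrix hU, spectralMatrix_mul hU, trace_spectralMatrix hU,
    Complex.ofReal_re]

theorem negEntropy_submatrix (e : m ≃ n) {X : Matrix n n ℂ} (hX : X.IsHermitian) :
    negEntropy (X.submatrix e e) = negEntropy X := by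
  obtain ⟨U, hU, d, rfl⟩ := exists_spectralMatrix hX
  rw [submatrix_spectralMatrix, negEntropy_spectralMatrix (submatrix_mem_unitaryGroup e hU),
    negEntropy_spectralMatrix hU]
  exact e.sum_comp fun i => d i * Real.logb 2 (d i)

/-- No positivity is needed: if a factor vanishes, so do both sides. -/
theorem mul_logb_mul (x y : ℝ) : x * y * Real.logb 2 (x * y) =
    x * Real.logb 2 x * y + x * (y * Real.logb 2 y) := by
  rcases eq_or_ne x 0 with rfl | hx
  · simp
  rcases eq_or_ne y 0 with rfl | hy
  · simp
  rw [Real.logb_mul hx hy]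
  ring

theorem negEntropy_kronecker {X : Matrix m m ℂ} {Y : Matrix n n ℂ} (hX : IsState X)
    (hY : IsState Y) : negEntropy (X ⊗ₖ Y) = negEntropy X + negEntropy Y := by
  obtain ⟨hX, tX⟩ := hX
  obtain ⟨hY, tY⟩ := hY
  obtain ⟨U, hU, d, rfl⟩ := exists_spectralMatrix hX.1
  obtain ⟨V, hV, e, rfl⟩ := exists_spectralMatrix hY.1
  rw [trace_spectralMatrix hU] at tX
  rw [trace_spectralMatrix hV] at tY
  have tX' : ∑ i, d i = 1 := by exact_mod_cast tX
  have tY' : ∑ i, e i = 1 := by exact_mod_cast tY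
  rw [spectralMatrix_kronecker, negEntropy_spectralMatrix (Matrix.kronecker_mem_unitary hU hV),
    negEntropy_spectralMatrix hU, negEntropy_spectralMatrix hV, Fintype.sum_prod_type]
  simp only [mul_logb_mul, Finset.sum_add_distrib, ← Finset.mul_sum, ← Finset.sum_mul, tX', tY',
    mul_one, one_mul]

end Spectral

/-! ### Partial trace and relative entropy to `X_R ⊗ 1/|B|` -/

section PartialTrace

variable {R B : Type*} [Fintype B]

/-- The partial trace over the second system. -/
def traceRight (X : Matrix (R × B) (R × B) ℂ) : Matrix R R ℂ :=
  Matrix.of fun r r' => ∑ b, X (r, b) (r', b)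

theorem trace_traceRight [Fintype R] (X : Matrix (R × B) (R × B) ℂ) : (traceRight X).trace = X.trace := by
  simp [Matrix.trace, traceRight, Fintype.sum_prod_type]

theorem traceRight_eq_sum (X : Matrix (R × B) (R × B) ℂ) :
    traceRight X = ∑ b, X.submatrix (fun r => (r, b)) (fun r => (r, b)) := by
  ext r r'
  simp [traceRight, Matrix.sum_apply]

theorem posSemidef_traceRight {X : Matrix (R × B) (R × B) ℂ} (hX : X.PosSemidef) :
    (traceRight X).PosSemidef := by
  rw [traceRight_eq_sum]
  exact Matrix.posSemidef_sum _ fun b _ => hX.submatrix _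

theorem IsState.traceRight [Fintype R] {X : Matrix (R × B) (R × B) ℂ} (hX : IsState X) :
    IsState (traceRight X) :=
  ⟨posSemidef_traceRight hX.1, by rw [trace_traceRight, hX.2]⟩

theorem trace_mul_kronecker_one [Fintype R] [DecidableEq B] (X : Matrix (R × B) (R × B) ℂ) (L : Matrix R R ℂ) :
    (X * (L ⊗ₖ (1 : Matrix B B ℂ))).trace = (traceRight X * L).trace := by
  simp only [Matrix.trace, Matrix.diag, Matrix.mul_apply, Matrix.kronecker_apply, traceRight,
    Matrix.of_apply, Fintype.sum_prod_type, Matrix.one_apply, mul_ite, mul_one, mul_zero,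
    Finset.sum_ite_eq', Finset.mem_univ, if_true, Finset.sum_mul]
  exact Finset.sum_congr rfl fun _ _ => Finset.sum_comm

/-- The kernel of `Tr_B X ⊗ 1` is contained in that of `X`. -/
theorem mulVec_eq_zero_of_traceRight [Fintype R] [DecidableEq B] {X : Matrix (R × B) (R × B) ℂ} (hX : X.PosSemidef)
    {v : R × B → ℂ} (hv : ∀ b, (traceRight X).mulVec (fun r => v (r, b)) = 0) :
    X.mulVec v = 0 := by
  have key : ∀ b b', X.mulVec (fun i => if i.2 = b' then v (i.1, b) else 0) = 0 := by
    intro b b'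
    set w : B → R × B → ℂ := fun b' i => if i.2 = b' then v (i.1, b) else 0 with hw
    -- `w b'` places the slice `v (·, b)` in block `b'`. Summed over `b'`, the quadratic forms of
    -- `X` give that of the partial trace at the slice, which is zero; each summand is nonnegative,
    -- hence zero.
    have hsum : ∑ b', star (w b') ⬝ᵥ X.mulVec (w b') = 0 := by
      have h0 : star (fun r => v (r, b)) ⬝ᵥ (traceRight X).mulVec (fun r => v (r, b)) = 0 := by
        rw [hv, dotProduct_zero]
      rw [← h0]
      simp only [dotProduct, Matrix.mulVec, traceRight, hw, Fintype.sum_prod_type, Pi.star_apply,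
        Matrix.of_apply, apply_ite star, star_zero, ite_mul, zero_mul, mul_ite, mul_zero,
        Finset.sum_ite_eq', Finset.mem_univ, if_true, Finset.sum_mul]
      rw [Finset.sum_comm]
      refine Finset.sum_congr rfl fun r _ => ?_
      rw [← Finset.mul_sum, Finset.sum_comm]
    have hz := (Finset.sum_eq_zero_iff_of_nonneg
      (fun b' _ => hX.dotProduct_mulVec_nonneg (w b'))).1 hsum b' (Finset.mem_univ _)
    exact (hX.dotProduct_mulVec_zero_iff _).1 hz
  have hv' : v = ∑ b, fun i : R × B => if i.2 = b then v (i.1, b) else 0 := by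
    ext ⟨r, b⟩
    simp [Finset.sum_apply]
  rw [hv', Matrix.mulVec_sum]
  exact Finset.sum_eq_zero fun b _ => key b b

/-- The logarithm of the second argument has the form `L ⊗ 1`, so its pairing with `X` sees only the
marginal of `X`. -/
theorem relEntropy_traceRight [Fintype R] [DecidableEq R] [DecidableEq B] [Nonempty B]
    {X : Matrix (R × B) (R × B) ℂ} (hX : IsState X) :
    relEntropy X (traceRight X ⊗ₖ ((Fintype.card B : ℂ)⁻¹ • (1 : Matrix B B ℂ))) =
      ((negEntropy X - negEntropy (traceRight X) + Real.logb 2 (Fintype.card B) : ℝ) : EReal) := by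
  have hb : (Fintype.card B : ℝ) ≠ 0 := by simp
  have hbC : (Fintype.card B : ℂ) ≠ 0 := by simp
  rw [relEntropy, if_pos]
  · congr 1
    rw [Matrix.mul_sub, Matrix.trace_sub, Complex.sub_re, ← negEntropy]
    obtain ⟨hX, tX⟩ := hX.traceRight
    obtain ⟨U, hU, d, hd⟩ := exists_spectralMatrix hX.1
    have hone : ∀ c : ℝ, (c : ℂ) • (1 : Matrix B B ℂ) = spectralMatrix 1 (fun _ => c) := by
      intro c
      simp [spectralMatrix, Matrix.smul_one_eq_diagonal]
    have hc : (Fintype.card B : ℂ)⁻¹ = (((Fintype.card B : ℝ)⁻¹ : ℝ) : ℂ) := by simp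
    have hL : cfc (Real.logb 2)
        (traceRight X ⊗ₖ ((Fintype.card B : ℂ)⁻¹ • (1 : Matrix B B ℂ))) =
        spectralMatrix U (fun i => Real.logb 2 (d i * (Fintype.card B : ℝ)⁻¹)) ⊗ₖ
          (1 : Matrix B B ℂ) := by
      have h1 : (1 : Matrix B B ℂ) = spectralMatrix 1 (fun _ => 1) := by
        rw [← hone]; simp
      conv_rhs => rw [h1]
      rw [hd, hc, hone, spectralMatrix_kronecker, spectralMatrix_kronecker,
        cfc_spectralMatrix (Matrix.kronecker_mem_unitary hU (one_mem _))]
      simp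
    rw [hL, trace_mul_kronecker_one, hd, spectralMatrix_mul hU, trace_spectralMatrix hU,
      Complex.ofReal_re, negEntropy_spectralMatrix hU]
    rw [hd, trace_spectralMatrix hU] at tX
    have tX' : ∑ i, d i = 1 := by exact_mod_cast tX
    have hsum : ∑ i, d i * Real.logb 2 (d i * (Fintype.card B : ℝ)⁻¹) =
        ∑ i, d i * Real.logb 2 (d i) - Real.logb 2 (Fintype.card B) := by
      rw [← one_mul (Real.logb 2 (Fintype.card B : ℝ)), ← tX', Finset.sum_mul,
        ← Finset.sum_sub_distrib]
      refine Finset.sum_congr rfl fun i _ => ?_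
      -- At a zero eigenvalue the logarithm of the product does not split, but its weight `d i`
      -- vanishes.
      rcases eq_or_ne (d i) 0 with h | h
      · simp [h]
      · rw [Real.logb_mul h (inv_ne_zero hb), Real.logb_inv]
        ring
    rw [hsum]
    ring
  · intro v hv
    refine mulVec_eq_zero_of_traceRight hX.1 fun b => ?_
    ext r
    have h := congrFun hv (r, b)
    simp only [Matrix.mulVec, dotProduct, Fintype.sum_prod_type, Matrix.kronecker_apply,
      Matrix.smul_apply, Matrix.one_apply, smul_eq_mul, mul_ite, mul_one, mul_zero, ite_mul,
      zero_mul, Finset.sum_ite_eq, Finset.mem_univ, if_true, Pi.zero_apply] at h ⊢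
    simp only [mul_right_comm _ (Fintype.card B : ℂ)⁻¹] at h
    rw [← Finset.sum_mul] at h
    exact (mul_eq_zero.1 h).resolve_right (inv_ne_zero hbC)

end PartialTrace

/-! ### Tensor products of maps, and regrouping of systems -/

section Tensor

variable {A B A₁ A₂ B₁ B₂ R : Type*} [Fintype A] [DecidableEq A] [Fintype A₁] [DecidableEq A₁]
  [Fintype A₂] [DecidableEq A₂]

theorem map_eq_sum_single (N : Matrix A A ℂ →ₗ[ℂ] Matrix B B ℂ) (X : Matrix A A ℂ) :
    N X = ∑ i, ∑ j, X i j • N (Matrix.single i j 1) := by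
  conv_lhs => rw [Matrix.matrix_eq_sum_single X]
  simp only [map_sum]
  refine Finset.sum_congr rfl fun i _ => Finset.sum_congr rfl fun j _ => ?_
  rw [← map_smul, Matrix.smul_single, smul_eq_mul, mul_one]

/-- A tensor product of maps acts by applying the first map to the blocks of its argument, and
then the second map to the blocks of the result. -/
theorem tensor_apply (N : Matrix A₁ A₁ ℂ →ₗ[ℂ] Matrix B₁ B₁ ℂ)
    (M : Matrix A₂ A₂ ℂ →ₗ[ℂ] Matrix B₂ B₂ ℂ) (X : Matrix (A₁ × A₂) (A₁ × A₂) ℂ)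
    (b c : B₁ × B₂) :
    tensor N M X b c = M (Matrix.of fun i j =>
      N (X.submatrix (fun k => (k, i)) (fun k => (k, j))) b.1 c.1) b.2 c.2 := by
  obtain ⟨b₁, b₂⟩ := b
  obtain ⟨c₁, c₂⟩ := c
  rw [map_eq_sum_single M]
  simp only [tensor, LinearMap.coe_mk, AddHom.coe_mk, Matrix.sum_apply, Matrix.smul_apply,
    Matrix.kronecker_apply, smul_eq_mul, Fintype.sum_prod_type, Matrix.of_apply]
  conv_rhs =>
    enter [2, i, 2, j]
    rw [map_eq_sum_single N, Matrix.sum_apply, Finset.sum_mul]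
  rw [Finset.sum_comm]
  refine Finset.sum_congr rfl fun i _ => ?_
  conv_rhs => rw [Finset.sum_comm]
  refine Finset.sum_congr rfl fun k _ => ?_
  rw [Finset.sum_comm]
  refine Finset.sum_congr rfl fun j _ => ?_
  simp only [Matrix.sum_apply, Matrix.smul_apply, smul_eq_mul, Finset.sum_mul,
    Matrix.submatrix_apply]
  exact Finset.sum_congr rfl fun l _ => by ring

/-- The action `id ⊗ N` of a map on one part of a composite system. -/
noncomputable abbrev idTensor (R : Type*) [Fintype R] [DecidableEq R]
    (N : Matrix A A ℂ →ₗ[ℂ] Matrix B B ℂ) :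
    Matrix (R × A) (R × A) ℂ →ₗ[ℂ] Matrix (R × B) (R × B) ℂ :=
  tensor (LinearMap.id : Matrix R R ℂ →ₗ[ℂ] Matrix R R ℂ) N

variable [Fintype R] [DecidableEq R]

theorem idTensor_apply (N : Matrix A A ℂ →ₗ[ℂ] Matrix B B ℂ) (X : Matrix (R × A) (R × A) ℂ)
    (b c : R × B) :
    idTensor R N X b c = N (X.submatrix (Prod.mk b.1) (Prod.mk c.1)) b.2 c.2 :=
  tensor_apply _ _ _ _ _

theorem idTensor_submatrix {S : Type*} [Fintype S] [DecidableEq S] (e : S ≃ R)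
    (N : Matrix A A ℂ →ₗ[ℂ] Matrix B B ℂ) (X : Matrix (R × A) (R × A) ℂ) :
    idTensor S N (X.submatrix (Equiv.prodCongr e (Equiv.refl A)) (Equiv.prodCongr e (Equiv.refl A)))
      = (idTensor R N X).submatrix (Equiv.prodCongr e (Equiv.refl B))
          (Equiv.prodCongr e (Equiv.refl B)) := by
  ext b c
  rw [Matrix.submatrix_apply, idTensor_apply, idTensor_apply]
  rfl

/-- Complete positivity is defined with ancillas `Fin k`; relabelling the basis extends it to
ancillas such as `R × B₁`. -/
theorem posSemidef_idTensor [Fintype B] {N : Matrix A A ℂ →ₗ[ℂ] Matrix B B ℂ}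
    (hN : IsCompletelyPositive N) {X : Matrix (R × A) (R × A) ℂ} (hX : X.PosSemidef) :
    (idTensor R N X).PosSemidef := by
  have h := hN _ _ (hX.submatrix (Equiv.prodCongr (Fintype.equivFin R).symm (Equiv.refl A)))
  rw [← idTensor, idTensor_submatrix] at h
  exact (Matrix.posSemidef_submatrix_equiv _).1 h

theorem traceRight_idTensor [Fintype B] {N : Matrix A A ℂ →ₗ[ℂ] Matrix B B ℂ}
    (hN : ∀ X, (N X).trace = X.trace) (X : Matrix (R × A) (R × A) ℂ) :
    traceRight (idTensor R N X) = traceRight X := by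
  ext r s
  simp only [traceRight, Matrix.of_apply, idTensor_apply]
  exact hN _

theorem IsState.idTensor [Fintype B] {N : Matrix A A ℂ →ₗ[ℂ] Matrix B B ℂ} (hN : IsChannel N)
    {X : Matrix (R × A) (R × A) ℂ} (hX : IsState X) : IsState (idTensor R N X) :=
  ⟨posSemidef_idTensor hN.1 hX.1, by
    rw [← trace_traceRight, traceRight_idTensor hN.2, trace_traceRight, hX.2]⟩

theorem IsState.submatrix {m n : Type*} [Fintype m] [Fintype n] (e : m ≃ n) {X : Matrix n n ℂ}
    (hX : IsState X) : IsState (X.submatrix e e) :=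
  ⟨hX.1.submatrix e, by rw [← hX.2]; exact e.sum_comp fun i => X i i⟩

theorem IsState.kronecker {m n : Type*} [Fintype m] [Fintype n] {X : Matrix m m ℂ}
    {Y : Matrix n n ℂ} (hX : IsState X) (hY : IsState Y) : IsState (X ⊗ₖ Y) :=
  ⟨hX.1.kronecker hY.1, by rw [Matrix.trace_kronecker, hX.2, hY.2, one_mul]⟩

theorem idTensor_randomizing [Fintype B] [DecidableEq B] (X : Matrix (R × A) (R × A) ℂ) :
    idTensor R (randomizing A B) X =
      traceRight X ⊗ₖ ((Fintype.card B : ℂ)⁻¹ • (1 : Matrix B B ℂ)) := by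
  ext b c
  rw [idTensor_apply]
  rfl

theorem tensor_randomizing [Fintype B₁] [DecidableEq B₁] [Fintype B₂] [DecidableEq B₂] :
    tensor (randomizing A₁ B₁) (randomizing A₂ B₂) = randomizing (A₁ × A₂) (B₁ × B₂) := by
  ext1 X
  ext b c
  rw [tensor_apply]
  simp only [randomizing, LinearMap.smulRight_apply, Matrix.traceLinearMap_apply, Matrix.trace,
    Matrix.diag, Matrix.smul_apply, Matrix.of_apply, Matrix.submatrix_apply, smul_eq_mul,
    Fintype.sum_prod_type, Fintype.card_prod, Nat.cast_mul, mul_inv, ← Finset.sum_mul]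
  rw [Finset.sum_comm, Matrix.one_apply, Matrix.one_apply, Matrix.one_apply]
  by_cases h1 : b.1 = c.1 <;> by_cases h2 : b.2 = c.2 <;> simp [h1, h2, Prod.ext_iff]
  ring

/-- Exchange of the last two of three systems. -/
def swapLast (R A B : Type*) : (R × A) × B ≃ (R × B) × A where
  toFun x := ((x.1.1, x.2), x.1.2)
  invFun x := ((x.1.1, x.2), x.1.2)

/-- The action of `id ⊗ N` on the second of three systems. -/
noncomputable def idTensorMiddle (N : Matrix A₁ A₁ ℂ →ₗ[ℂ] Matrix B₁ B₁ ℂ)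
    (X : Matrix (R × (A₁ × A₂)) (R × (A₁ × A₂)) ℂ) : Matrix ((R × B₁) × A₂) ((R × B₁) × A₂) ℂ :=
  (idTensor (R × A₂) N (X.submatrix ((swapLast R A₂ A₁).trans (Equiv.prodAssoc R A₁ A₂))
    ((swapLast R A₂ A₁).trans (Equiv.prodAssoc R A₁ A₂)))).submatrix
      (swapLast R B₁ A₂) (swapLast R B₁ A₂)

/-- Applying `N` first turns its output `B₁` into part of the reference for `M`. -/
theorem idTensor_tensor [Fintype B₁] [DecidableEq B₁] (N : Matrix A₁ A₁ ℂ →ₗ[ℂ] Matrix B₁ B₁ ℂ)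
    (M : Matrix A₂ A₂ ℂ →ₗ[ℂ] Matrix B₂ B₂ ℂ) (X : Matrix (R × (A₁ × A₂)) (R × (A₁ × A₂)) ℂ) :
    idTensor R (tensor N M) X = (idTensor (R × B₁) M (idTensorMiddle N X)).submatrix
      (Equiv.prodAssoc R B₁ B₂).symm (Equiv.prodAssoc R B₁ B₂).symm := by
  ext b c
  rw [idTensor_apply, tensor_apply, Matrix.submatrix_apply, idTensor_apply]
  refine congrArg (fun Z => M Z b.2.2 c.2.2) ?_
  ext i j
  rw [idTensorMiddle, Matrix.submatrix_apply, Matrix.submatrix_apply, idTensor_apply]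
  rfl

theorem posSemidef_idTensorMiddle [Fintype B₁] {N : Matrix A₁ A₁ ℂ →ₗ[ℂ] Matrix B₁ B₁ ℂ}
    (hN : IsCompletelyPositive N) {X : Matrix (R × (A₁ × A₂)) (R × (A₁ × A₂)) ℂ}
    (hX : X.PosSemidef) : (idTensorMiddle N X).PosSemidef :=
  (posSemidef_idTensor hN (hX.submatrix _)).submatrix _

theorem IsState.idTensorMiddle [Fintype B₁] {N : Matrix A₁ A₁ ℂ →ₗ[ℂ] Matrix B₁ B₁ ℂ}
    (hN : IsChannel N) {X : Matrix (R × (A₁ × A₂)) (R × (A₁ × A₂)) ℂ}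
    (hX : IsState X) : IsState (idTensorMiddle N X) :=
  ((hX.submatrix _).idTensor hN).submatrix _

/-- The partial trace over the last system commutes with the action on the middle one. -/
theorem traceRight_idTensorMiddle (N : Matrix A₁ A₁ ℂ →ₗ[ℂ] Matrix B₁ B₁ ℂ)
    (X : Matrix (R × (A₁ × A₂)) (R × (A₁ × A₂)) ℂ) :
    traceRight (idTensorMiddle N X) = idTensor R N (traceRight
      (X.submatrix (Equiv.prodAssoc R A₁ A₂) (Equiv.prodAssoc R A₁ A₂))) := by
  ext b c
  rw [idTensor_apply]
  have h : (traceRight (X.submatrix (Equiv.prodAssoc R A₁ A₂)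
      (Equiv.prodAssoc R A₁ A₂))).submatrix (Prod.mk b.1) (Prod.mk c.1) =
      ∑ a, X.submatrix (fun i => (b.1, (i, a))) (fun i => (c.1, (i, a))) := by
    ext i j
    simp [traceRight, Matrix.sum_apply]
  rw [h, map_sum, Matrix.sum_apply]
  simp only [traceRight, Matrix.of_apply, idTensorMiddle, Matrix.submatrix_apply, idTensor_apply]
  rfl

theorem traceRight_traceRight {R : Type*} [Fintype B₁] [Fintype B₂]
    (X : Matrix (R × (B₁ × B₂)) (R × (B₁ × B₂)) ℂ) :
    traceRight (traceRight (X.submatrix (Equiv.prodAssoc R B₁ B₂) (Equiv.prodAssoc R B₁ B₂))) =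
      traceRight X := by
  ext r s
  simp [traceRight, Fintype.sum_prod_type]

theorem IsChannel.tensor [Fintype B₁] [Fintype B₂]
    {N : Matrix A₁ A₁ ℂ →ₗ[ℂ] Matrix B₁ B₁ ℂ} (hN : IsChannel N)
    {M : Matrix A₂ A₂ ℂ →ₗ[ℂ] Matrix B₂ B₂ ℂ} (hM : IsChannel M) : IsChannel (tensor N M) := by
  classical
  refine ⟨fun k X hX => ?_, fun X => ?_⟩
  · rw [← QuantumChannel.idTensor, idTensor_tensor]
    exact (posSemidef_idTensor hM.1 (posSemidef_idTensorMiddle hN.1 hX)).submatrix _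
  -- Tracing over `B₂` first removes `M`; what remains is the traces of `N` on the diagonal blocks.
  · have h : (QuantumChannel.tensor N M X).trace = ∑ b, (M (Matrix.of fun i j =>
        N (X.submatrix (fun k => (k, i)) (fun k => (k, j))) b b)).trace := by
      simp only [Matrix.trace, Matrix.diag, tensor_apply, Fintype.sum_prod_type]
    have h' : ∀ a : A₂, ∑ b, N (X.submatrix (fun k => (k, a)) (fun k => (k, a))) b b =
        ∑ k, X (k, a) (k, a) := fun a => hN.2 _
    rw [h]
    simp only [hM.2]
    simp only [Matrix.trace, Matrix.diag, Matrix.of_apply]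
    rw [Finset.sum_comm]
    simp only [h', Fintype.sum_prod_type]
    exact Finset.sum_comm

/-- The four-system reshuffle regrouping references and inputs. -/
theorem idTensor_kronecker {R₁ R₂ : Type*} [Fintype R₁] [DecidableEq R₁] [Fintype R₂]
    [DecidableEq R₂] (N : Matrix A₁ A₁ ℂ →ₗ[ℂ] Matrix B₁ B₁ ℂ)
    (M : Matrix A₂ A₂ ℂ →ₗ[ℂ] Matrix B₂ B₂ ℂ) (X : Matrix (R₁ × A₁) (R₁ × A₁) ℂ)
    (Y : Matrix (R₂ × A₂) (R₂ × A₂) ℂ) :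
    idTensor (R₁ × R₂) (tensor N M) ((X ⊗ₖ Y).submatrix (Equiv.prodProdProdComm R₁ R₂ A₁ A₂)
      (Equiv.prodProdProdComm R₁ R₂ A₁ A₂)) =
    (idTensor R₁ N X ⊗ₖ idTensor R₂ M Y).submatrix (Equiv.prodProdProdComm R₁ R₂ B₁ B₂)
      (Equiv.prodProdProdComm R₁ R₂ B₁ B₂) := by
  ext b c
  have h : ((X ⊗ₖ Y).submatrix (Equiv.prodProdProdComm R₁ R₂ A₁ A₂)
      (Equiv.prodProdProdComm R₁ R₂ A₁ A₂)).submatrix (Prod.mk b.1) (Prod.mk c.1) =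
      X.submatrix (Prod.mk b.1.1) (Prod.mk c.1.1) ⊗ₖ
        Y.submatrix (Prod.mk b.1.2) (Prod.mk c.1.2) := rfl
  rw [idTensor_apply, h, tensor_kronecker, Matrix.submatrix_apply, Matrix.kronecker_apply,
    Matrix.kronecker_apply, idTensor_apply, idTensor_apply]
  rfl

theorem traceRight_kronecker {R₁ R₂ : Type*} [Fintype B₁] [Fintype B₂]
    (X : Matrix (R₁ × B₁) (R₁ × B₁) ℂ) (Y : Matrix (R₂ × B₂) (R₂ × B₂) ℂ) :
    traceRight ((X ⊗ₖ Y).submatrix (Equiv.prodProdProdComm R₁ R₂ B₁ B₂)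
      (Equiv.prodProdProdComm R₁ R₂ B₁ B₂)) = traceRight X ⊗ₖ traceRight Y := by
  ext r s
  simp [traceRight, Fintype.sum_prod_type, Finset.sum_mul_sum]

end Tensor

/-! ### Chain rule, product inputs and additivity -/

section Additivity

variable {A B A₁ A₂ B₁ B₂ R : Type*} [Fintype A] [DecidableEq A] [Fintype A₁] [DecidableEq A₁]
  [Fintype A₂] [DecidableEq A₂] [Fintype B] [DecidableEq B] [Fintype B₁] [DecidableEq B₁]
  [Fintype B₂] [DecidableEq B₂] [Fintype R] [DecidableEq R]

/-- The relative entropy of the outputs of `N` and of the completely randomizing channel on the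
input `X`, as a difference of von Neumann entropies. -/
noncomputable def outputDivergence (N : Matrix A A ℂ →ₗ[ℂ] Matrix B B ℂ)
    (X : Matrix (R × A) (R × A) ℂ) : ℝ :=
  negEntropy (idTensor R N X) - negEntropy (traceRight X) + Real.logb 2 (Fintype.card B)

theorem relEntropy_idTensor_randomizing [Nonempty B] {N : Matrix A A ℂ →ₗ[ℂ] Matrix B B ℂ}
    (hN : IsChannel N) {X : Matrix (R × A) (R × A) ℂ} (hX : IsState X) :
    relEntropy (idTensor R N X) (idTensor R (randomizing A B) X) =
      (outputDivergence N X : EReal) := by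
  rw [idTensor_randomizing, ← traceRight_idTensor hN.2, relEntropy_traceRight (hX.idTensor hN),
    traceRight_idTensor hN.2, outputDivergence]

theorem IsChannel.nonempty {B : Type*} [Fintype B] [Nonempty A] {N : Matrix A A ℂ →ₗ[ℂ] Matrix B B ℂ}
    (hN : IsChannel N) : Nonempty B := by
  by_contra h
  rw [not_nonempty_iff] at h
  have h1 := hN.2 1
  rw [Matrix.trace_one, Matrix.trace, Finset.univ_eq_empty, Finset.sum_empty] at h1
  exact absurd h1.symm (by simp)

theorem channelRelEntropy_le_iff [Nonempty B] {N : Matrix A A ℂ →ₗ[ℂ] Matrix B B ℂ}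
    (hN : IsChannel N) {c : EReal} : channelRelEntropy N (randomizing A B) ≤ c ↔
      ∀ (n : ℕ) (X : Matrix (Fin n × A) (Fin n × A) ℂ), IsState X →
        (outputDivergence N X : EReal) ≤ c := by
  simp only [channelRelEntropy, iSup_le_iff]
  refine forall_congr' fun n => forall_congr' fun X => forall_congr' fun hX => ?_
  rw [← relEntropy_idTensor_randomizing hN hX]

/-- The supremum ranges over references `Fin n` only; invariance of entropy under relabelling admits
any finite `R`. -/
theorem outputDivergence_le [Nonempty B] {N : Matrix A A ℂ →ₗ[ℂ] Matrix B B ℂ}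
    (hN : IsChannel N) {X : Matrix (R × A) (R × A) ℂ} (hX : IsState X) :
    (outputDivergence N X : EReal) ≤ channelRelEntropy N (randomizing A B) := by
  have h := (channelRelEntropy_le_iff hN).1 le_rfl _ _
    (hX.submatrix (Equiv.prodCongr (Fintype.equivFin R).symm (Equiv.refl A)))
  have ht : traceRight (X.submatrix (Equiv.prodCongr (Fintype.equivFin R).symm (Equiv.refl A))
      (Equiv.prodCongr (Fintype.equivFin R).symm (Equiv.refl A))) =
      (traceRight X).submatrix (Fintype.equivFin R).symm (Fintype.equivFin R).symm := rfl
  rwa [outputDivergence, idTensor_submatrix, ht, negEntropy_submatrix _ (hX.idTensor hN).1.1,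
    negEntropy_submatrix _ hX.traceRight.1.1, ← outputDivergence] at h

theorem bot_lt_channelRelEntropy_randomizing [Nonempty A] {N : Matrix A A ℂ →ₗ[ℂ] Matrix B B ℂ}
    (hN : IsChannel N) : ⊥ < channelRelEntropy N (randomizing A B) := by
  have := hN.nonempty
  obtain ⟨a⟩ := ‹Nonempty A›
  -- Any state gives a finite lower bound; this is a basis state with a one-dimensional reference.
  have hX : IsState (Matrix.diagonal (Pi.single ((0 : Fin 1), a) (1 : ℂ))) := by
    refine ⟨Matrix.PosSemidef.diagonal (Pi.single_nonneg.2 zero_le_one), ?_⟩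
    rw [Matrix.trace_diagonal, Finset.sum_pi_single']
    simp
  exact (EReal.bot_lt_coe _).trans_le (outputDivergence_le hN hX)

/-- The chain rule for the output divergence of a tensor product. -/
theorem outputDivergence_tensor [Nonempty B₁] [Nonempty B₂]
    {N : Matrix A₁ A₁ ℂ →ₗ[ℂ] Matrix B₁ B₁ ℂ} (hN : IsChannel N)
    {M : Matrix A₂ A₂ ℂ →ₗ[ℂ] Matrix B₂ B₂ ℂ} (hM : IsChannel M)
    {X : Matrix (R × (A₁ × A₂)) (R × (A₁ × A₂)) ℂ} (hX : IsState X) :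
    outputDivergence (tensor N M) X =
      outputDivergence N
        (traceRight (X.submatrix (Equiv.prodAssoc R A₁ A₂) (Equiv.prodAssoc R A₁ A₂))) +
      outputDivergence M (idTensorMiddle N X) := by
  -- The entropy of the `R × B₁` marginal occurs in both summands with opposite signs and cancels.
  rw [outputDivergence, outputDivergence, outputDivergence, idTensor_tensor,
    negEntropy_submatrix _ ((hX.idTensorMiddle hN).idTensor hM).1.1, traceRight_idTensorMiddle,
    traceRight_traceRight, Fintype.card_prod, Nat.cast_mul, Real.logb_mul (by simp) (by simp)]
  ring

theorem outputDivergence_kronecker [Nonempty B₁] [Nonempty B₂] {R₁ R₂ : Type*} [Fintype R₁]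
    [DecidableEq R₁] [Fintype R₂] [DecidableEq R₂]
    {N : Matrix A₁ A₁ ℂ →ₗ[ℂ] Matrix B₁ B₁ ℂ} (hN : IsChannel N)
    {M : Matrix A₂ A₂ ℂ →ₗ[ℂ] Matrix B₂ B₂ ℂ} (hM : IsChannel M)
    {X : Matrix (R₁ × A₁) (R₁ × A₁) ℂ} (hX : IsState X)
    {Y : Matrix (R₂ × A₂) (R₂ × A₂) ℂ} (hY : IsState Y) :
    outputDivergence (tensor N M) ((X ⊗ₖ Y).submatrix (Equiv.prodProdProdComm R₁ R₂ A₁ A₂)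
      (Equiv.prodProdProdComm R₁ R₂ A₁ A₂)) = outputDivergence N X + outputDivergence M Y := by
  have hX' := hX.idTensor hN
  have hY' := hY.idTensor hM
  rw [outputDivergence, outputDivergence, outputDivergence, idTensor_kronecker,
    negEntropy_submatrix _ (hX'.kronecker hY').1.1, traceRight_kronecker,
    negEntropy_kronecker hX' hY', negEntropy_kronecker hX.traceRight hY.traceRight,
    Fintype.card_prod, Nat.cast_mul, Real.logb_mul (by simp) (by simp)]
  ring

theorem channelRelEntropy_tensor_randomizing [Nonempty A₁] [Nonempty A₂]
    {N : Matrix A₁ A₁ ℂ →ₗ[ℂ] Matrix B₁ B₁ ℂ} (hN : IsChannel N)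
    {M : Matrix A₂ A₂ ℂ →ₗ[ℂ] Matrix B₂ B₂ ℂ} (hM : IsChannel M) :
    channelRelEntropy (tensor N M) (randomizing (A₁ × A₂) (B₁ × B₂)) =
      channelRelEntropy N (randomizing A₁ B₁) + channelRelEntropy M (randomizing A₂ B₂) := by
  have := hN.nonempty
  have := hM.nonempty
  have hNM := hN.tensor hM
  refine le_antisymm ((channelRelEntropy_le_iff hNM).2 fun n X hX => ?_)
    -- Working with strict lower bounds `a`, `b` of the two suprema requires neither attainment nor
    -- finiteness.
    (EReal.add_le_of_forall_lt fun a ha b hb => ?_)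
  · rw [outputDivergence_tensor hN hM hX, EReal.coe_add]
    exact add_le_add (outputDivergence_le hN (hX.submatrix _).traceRight)
      (outputDivergence_le hM (hX.idTensorMiddle hN))
  · rw [← not_le, channelRelEntropy_le_iff hN] at ha
    rw [← not_le, channelRelEntropy_le_iff hM] at hb
    push Not at ha hb
    obtain ⟨n, X, hX, haX⟩ := ha
    obtain ⟨k, Y, hY, hbY⟩ := hb
    refine (add_le_add haX.le hbY.le).trans ?_
    rw [← EReal.coe_add, ← outputDivergence_kronecker hN hM hX hY]
    exact outputDivergence_le hNM ((hX.kronecker hY).submatrix _)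

/-- Since `⊥ + ⊤ = ⊥` in `EReal`, the identity fails for `x = ⊥`, `y = ⊤`. Excluding `⊥` suffices,
so the suprema need not be shown finite. -/
theorem coe_add_sub_add (a b : ℝ) {x y : EReal} (hx : ⊥ < x) (hy : ⊥ < y) :
    ((a + b : ℝ) : EReal) - (x + y) = (a - x) + (b - y) := by
  induction x with
  | bot => exact absurd hx (lt_irrefl _)
  | top => simp [EReal.top_add_of_ne_bot hy.ne']
  | coe x =>
    induction y with
    | bot => exact absurd hy (lt_irrefl _)
    | top => simp
    | coe y =>
      norm_cast
      ring

end Additivity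
end QuantumChannel

theorem mainTheorem4 {A₁ A₂ B₁ B₂ : Type*}
    [Fintype A₁] [DecidableEq A₁] [Nonempty A₁] [Fintype A₂] [DecidableEq A₂] [Nonempty A₂]
    [Fintype B₁] [DecidableEq B₁] [Fintype B₂] [DecidableEq B₂]
    (N : Matrix A₁ A₁ ℂ →ₗ[ℂ] Matrix B₁ B₁ ℂ) (hN : QuantumChannel.IsChannel N)
    (M : Matrix A₂ A₂ ℂ →ₗ[ℂ] Matrix B₂ B₂ ℂ) (hM : QuantumChannel.IsChannel M) :
    QuantumChannel.channelEntropy (QuantumChannel.tensor N M) =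
        QuantumChannel.channelEntropy N + QuantumChannel.channelEntropy M ∧
      QuantumChannel.channelRelEntropy (QuantumChannel.tensor N M)
          (QuantumChannel.tensor (QuantumChannel.randomizing A₁ B₁)
            (QuantumChannel.randomizing A₂ B₂)) =
        QuantumChannel.channelRelEntropy N (QuantumChannel.randomizing A₁ B₁) +
          QuantumChannel.channelRelEntropy M (QuantumChannel.randomizing A₂ B₂) := by
  have := hN.nonempty
  have := hM.nonempty
  have h := QuantumChannel.channelRelEntropy_tensor_randomizing hN hM
  refine ⟨?_, by rw [QuantumChannel.tensor_randomizing, h]⟩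
  rw [QuantumChannel.channelEntropy, h, Fintype.card_prod, Nat.cast_mul,
    Real.logb_mul (by simp) (by simp)]
  exact QuantumChannel.coe_add_sub_add _ _
    (QuantumChannel.bot_lt_channelRelEntropy_randomizing hN)
    (QuantumChannel.bot_lt_channelRelEntropy_randomizing hM)
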